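/- **Setting.** Let $X\subseteq\mathbb{R}^n$ be measurable and let $\mathcal{D}$ be the set of probability density functions on $X$ (with respect to Lebesgue measure); for measurable $P\subseteq X$ let $\mathcal{D}_P=\{p\in\mathcal{D}: p(x)>0\Rightarrow x\in P\}$. Let $D(\cdot\Vert\cdot)$ denote the Kullback–Leibler divergence, with values in $[0,\infty]$. A *lower-semicontinuous linear functional* is a map $G:\mathcal{D}\to\mathbb{R}\cup\{+\infty\}$ with $G((1-\lambda)r+\lambda p)=(1-\lambda)G(r)+\lambda G(p)$ for $p,r\in\mathcal{D}$, $\lambda\in(0,1)$, which is lower semicontinuous for the total variation distance. Let $\Sigma:\mathcal{D}\to\mathbb{R}\cup\{+\infty\}$ be a classical entropy production (EP) of one of the following two forms, where $G$ is a lower-semicontinuous linear functional. 1. *Trajectory form.* Let $\tau\ge 0$, let $x\mapsto\tilde x$ be a measurable involution of $X$ (conjugation of odd variables), and let $\mathrm{P}(\boldsymbol{x}|x_0)$ and $\tilde{\mathrm{P}}(\tilde{\boldsymbol{x}}|\tilde x_\tau)$ be Markov kernels from $X$ to the space of trajectories $[0,\tau]\to X$, each giving almost surely trajectories that start at the conditioning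 state (the forward and the time-reversed protocol). When $x_0$ has density $p$, let $p'=Tp$ be the law of $x_\tau$ under the forward protocol. Then $$\Sigma(p)=D\big(\mathrm{P}(\boldsymbol{X}|X_0)\,p(X_0)\,\big\Vert\,\tilde{\mathrm{P}}(\tilde{\boldsymbol{X}}|\tilde X_\tau)\,p'(X_\tau)\big)+G(p),$$ where the second argument is the law of the trajectory $\boldsymbol{x}$ obtained by drawing $x_\tau$ from $p'$, drawing $\tilde{\boldsymbol{x}}$ from $\tilde{\mathrm P}(\cdot|\tilde x_\tau)$, and setting $x_t$ to be the conjugate of the state of $\tilde{\boldsymbol{x}}$ at time $\tau-t$. 2. *System–bath form.* Let $Y\subseteq\mathbb{R}^m$ be measurable, let $q(y|x)$ be a conditional distribution of $y\in Y$ given $x\in X$, and let $g:X\times Y\to X\times Y$ be a measurable, volume-preserving bijection with measurable inverse (for instance the time-$\tau$ map of a Hamiltonian flow). Let $p'(x_\tau,y_\tau)$ be the law of $g(x_0,y_0)$ when $(x_0,y_0)$ is distributed as $p(x_0)q(y_0|x_0)$, and let $Tp=p'(x_\tau)$ be its marginal on $X$. Then $$\Sigma(p)=D\big(p'(X_\tau,Y_\tau)\,\big\Vert\,p'(X_\tau)\,q(Y_\tau|X_\tau)\big)+G(p).$$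 **Claim.** (a) Let $P\subseteq X$ be measurable, let $r\in\arg\min_{w\in\mathcal{D}_P}\Sigma(w)$ with $\Sigma(r)<\infty$, and let $p\in\mathcal{D}_P$ with $D(p\Vert r)<\infty$. Then $\Sigma(p)<\infty$, $D(Tp\Vert Tr)<\infty$, and $$\Sigma(p)-\Sigma(r)=D(p\Vert r)-D(Tp\Vert Tr).$$ (b) Let $\mathcal{S}\subseteq\mathcal{D}$ be any convex set, let $r\in\arg\min_{w\in\mathcal{S}}\Sigma(w)$ with $\Sigma(r)<\infty$, and let $p\in\mathcal{S}$ with $D(p\Vert r)<\infty$. Then $D(Tp\Vert Tr)<\infty$ and $$\Sigma(p)-\Sigma(r)\ \ge\ D(p\Vert r)-D(Tp\Vert Tr),$$ where $\Sigma(p)=\infty$ is allowed. If moreover $(1-\lambda)r+\lambda p\in\mathcal{S}$ for some $\lambda<0$, then $\Sigma(p)<\infty$ and equality holds. -/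

import Mathlib

open MeasureTheory ProbabilityTheory InformationTheory Set
open scoped ENNReal

-- A subset of `ℝⁿ` carries the Lebesgue measure.
attribute [local instance] Measure.Subtype.measureSpace

namespace ClassicalEP

noncomputable section

section Densities

variable {X : Type*} [MeasureSpace X]

/-- The set `𝒟` of probability density functions over `X` (with respect to `volume`). -/
def densities (X : Type*) [MeasureSpace X] : Set (X → ℝ) :=
  {p | Measurable p ∧ (∀ x, 0 ≤ p x) ∧ ∫⁻ x, ENNReal.ofReal (p x) = 1}

/-- The set `𝒟_P` of probability density functions whose support `{x | p x > 0}` lies in `P`. -/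
def densitiesOn (P : Set X) : Set (X → ℝ) :=
  {p | p ∈ densities X ∧ ∀ x, 0 < p x → x ∈ P}

/-- The probability measure with density `p`. -/
def law (p : X → ℝ) : Measure X :=
  volume.withDensity fun x => ENNReal.ofReal (p x)

/-- The KL divergence `D(p‖r)` of two probability densities. -/
def D (p r : X → ℝ) : ℝ≥0∞ := klDiv (law p) (law r)

/-- The total variation distance between two probability densities. -/
def tvDist (p r : X → ℝ) : ℝ := (1 / 2) * ∫ x, |p x - r x|

/-- `G : 𝒟 → ℝ ∪ {∞}` is a linear functional (it respects mixtures of densities) that is lower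
semicontinuous for the total variation distance. Values of `G` outside `𝒟` play no role. -/
structure IsLSCLinear (G : (X → ℝ) → EReal) : Prop where
  ne_bot : ∀ p ∈ densities X, G p ≠ ⊥
  mix : ∀ p ∈ densities X, ∀ r ∈ densities X, ∀ l : ℝ, 0 < l → l < 1 →
    G ((1 - l) • r + l • p) = ((1 - l : ℝ) : EReal) * G r + (l : EReal) * G p
  lsc : ∀ p ∈ densities X, ∀ c : EReal, c < G p →
    ∃ δ : ℝ, 0 < δ ∧ ∀ w ∈ densities X, tvDist w p < δ → c < G w

end Densities

/-! ### First form: forward and backward trajectory distributions -/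

/-- Trajectories `{x_t : t ∈ [0, τ]}`, with the σ-algebra generated by the coordinates. -/
abbrev Trajectory (X : Type*) (τ : ℝ) : Type _ := Icc (0 : ℝ) τ → X

/-- A driven stochastic process on `X` over the time interval `[0, τ]`, together with the process
under the time-reversed driving protocol. -/
structure DrivenProcess (X : Type*) [MeasurableSpace X] where
  /-- the duration -/
  τ : ℝ
  τ_nonneg : 0 ≤ τ
  /-- the conjugation `x ↦ x̃` of the odd variables (the identity if there are none) -/
  conj : X → X
  measurable_conj : Measurable conj
  conj_conj : ∀ x, conj (conj x) = x
  /-- the distribution of the trajectory under the forward protocol, given its initial state -/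
  fwd : Kernel X (Trajectory X τ)
  fwd_markov : IsMarkovKernel fwd
  fwd_start : ∀ x₀, (fwd x₀).map (fun x => x ⟨0, le_rfl, τ_nonneg⟩) = Measure.dirac x₀
  /-- the distribution of the trajectory under the time-reversed protocol, given its initial
  state -/
  bwd : Kernel X (Trajectory X τ)
  bwd_markov : IsMarkovKernel bwd
  bwd_start : ∀ x₀, (bwd x₀).map (fun x => x ⟨0, le_rfl, τ_nonneg⟩) = Measure.dirac x₀

namespace DrivenProcess

/-- Time reversal of a trajectory: `(x̃)_t` is the conjugate of `x_{τ - t}`. -/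
def reverse {X : Type*} [MeasurableSpace X] (W : DrivenProcess X) (x : Trajectory X W.τ) :
    Trajectory X W.τ :=
  fun t => W.conj (x ⟨W.τ - t, sub_nonneg.2 t.2.2, sub_le_self _ t.2.1⟩)

variable {X : Type*} [MeasureSpace X] (W : DrivenProcess X)

/-- `P(𝒙 | x₀) p(x₀)`: the law of the trajectory under the forward protocol, when the initial
state has density `p`. -/
def forwardLaw (p : X → ℝ) : Measure (Trajectory X W.τ) := (law p).bind W.fwd

/-- `T p`: the law of the final state `x_τ`, when the initial state has density `p`. -/
def finalLaw (p : X → ℝ) : Measure X :=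
  (W.forwardLaw p).map fun x => x ⟨W.τ, W.τ_nonneg, le_rfl⟩

/-- `P̃(𝒙̃ | x̃_τ) p'(x_τ)`, as a law of the trajectory `𝒙`: draw `x_τ` from `p' = T p`, run the
time-reversed protocol from the conjugate state `x̃_τ`, and reverse the resulting trajectory. -/
def backwardLaw (p : X → ℝ) : Measure (Trajectory X W.τ) :=
  (((W.finalLaw p).map W.conj).bind W.bwd).map W.reverse

/-- EP in trajectory form: `Σ(p) = D(P(𝒙 | x₀) p(x₀) ‖ P̃(𝒙̃ | x̃_τ) p'(x_τ)) + G(p)`. -/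
def ep (G : (X → ℝ) → EReal) (p : X → ℝ) : EReal :=
  (klDiv (W.forwardLaw p) (W.backwardLaw p) : EReal) + G p

end DrivenProcess

/-! ### Second form: Hamiltonian evolution of system and bath -/

/-- A system `X` and a bath `Y` that evolve jointly by an invertible volume-preserving map (such as
the time-`τ` map of a Hamiltonian flow), with a conditional distribution of the bath given the
system. -/
structure SystemBath (X Y : Type*) [MeasureSpace X] [MeasureSpace Y] where
  /-- the evolution map `(x₀, y₀) ↦ (x_τ, y_τ)` -/
  flow : X × Y ≃ᵐ X × Y
  volume_preserving : MeasurePreserving flow volume volume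
  /-- the conditional distribution `q(y | x)` of the bath state given the system state -/
  q : Kernel X Y
  q_markov : IsMarkovKernel q

namespace SystemBath

variable {X Y : Type*} [MeasureSpace X] [MeasureSpace Y] (W : SystemBath X Y)

/-- `p'(x_τ, y_τ)`: the final joint law, starting from `p(x₀) q(y₀ | x₀)`. -/
def finalJointLaw (p : X → ℝ) : Measure (X × Y) := ((law p).compProd W.q).map W.flow

/-- `T p`: the law `p'(x_τ)` of the final state of the system. -/
def finalLaw (p : X → ℝ) : Measure X := (W.finalJointLaw p).map Prod.fst

/-- EP in system-bath form:
`Σ(p) = D(p'(x_τ, y_τ) ‖ p'(x_τ) q(y_τ | x_τ)) + G(p)`. -/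
def ep (G : (X → ℝ) → EReal) (p : X → ℝ) : EReal :=
  (klDiv (W.finalJointLaw p) ((W.finalLaw p).compProd W.q) : EReal) + G p

end SystemBath

/-- `IsEPType Sig T`: the functional `Sig` is a classical entropy production, in one of the two
forms, of a process with state space `X` that takes the initial density `p` to the final
law `T p`. -/
inductive IsEPType {X : Type*} [MeasureSpace X] :
    ((X → ℝ) → EReal) → ((X → ℝ) → Measure X) → Prop
  | trajectory (W : DrivenProcess X) (G : (X → ℝ) → EReal) (hG : IsLSCLinear G) :
      IsEPType (W.ep G) W.finalLaw
  | systemBath (m : ℕ) (Y : Set (EuclideanSpace ℝ (Fin m))) (hY : MeasurableSet Y)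
      (W : SystemBath X Y) (G : (X → ℝ) → EReal) (hG : IsLSCLinear G) :
      IsEPType (W.ep G) W.finalLaw

/-- `r ∈ argmin_{w ∈ S} Sig(w)`, the minimum being finite from above. -/
structure IsMinimizer {X : Type*} (Sig : (X → ℝ) → EReal) (S : Set (X → ℝ)) (r : X → ℝ) :
    Prop where
  mem : r ∈ S
  min : ∀ w ∈ S, Sig r ≤ Sig w
  lt_top : Sig r < ⊤

end

end ClassicalEP

open ClassicalEP

/-! Both forms are instances of one scheme: a forward kernel `A` and a backward kernel `B` into a
common space `Ω`, where a map `i` recovers the input of `A` and a map `j` that of `B`. With `Tp` the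
image under `j` of `A ∘ₘ law p`, the EP is `D(A p ‖ B Tp) + G(p)`.

Fix a minimizer `r` and let `D(p ‖ r) < ∞`. The log-likelihood ratio of `A p` against `B Tr` factors
in two ways, through `A r` and through `B Tp`. Since inputs are recoverable, `D(A p ‖ A r) = D(p ‖
r)`, and the ratio of `B Tp` to `B Tr` is that of `Tp` to `Tr` at `j`. Integrating gives, whenever
`Σ(p) < ∞`, `Σ(p) = D(p ‖ r) - D(Tp ‖ Tr) + L(p)`, where `L(p)` is the `A p`-mean of the stochastic
EP of `r` plus `G(p)` (`IsProtocol.kernelEP_eq`). The functional `L` respects mixtures and `L(r) =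
Σ(r)`, so everything reduces to comparing `L(p)` with `L(r)`.

Along the segment from `r` to `p` the divergence from `r` is `o(l)`, so minimality gives `L(r) ≤
L(p)`: this is the inequality in (b). If the segment extends beyond `r` to some `s`, then `r` is a
proper mixture of `s` and `p`, and `L(s), L(p) ≥ L(r)` force equality. Finiteness of `Σ(p)` comes
along, because a mixture is finite only if both components are.

In (a) the segment need not extend, but it does for the normalized truncation of `p` at `k r`, which
is bounded by a multiple of `r`. So `L` equals `L(r)` on truncations. As `k → ∞`, monotone
convergence for the path term and lower semicontinuity of `G` give `Σ(p) < ∞` and `L(p) ≤ L(r)`. -/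

namespace ClassicalEP

open Filter Topology

/-! ### Kernels whose input is a function of their output -/

section Retract

variable {X Ω : Type*} [MeasurableSpace X] [MeasurableSpace Ω] {κ : Kernel X Ω} {i : Ω → X}

lemma map_comp_of_retract (hi : Measurable i) (h : ∀ x, (κ x).map i = Measure.dirac x)
    (μ : Measure X) : (κ ∘ₘ μ).map i = μ := by
  rw [Measure.map_comp _ _ hi]
  have : κ.map i = Kernel.id := by
    ext1 x
    rw [Kernel.map_apply _ hi, h, Kernel.id_apply]
  rw [this, Measure.id_comp]

lemma ae_comp_eq_of_retract (hi : Measurable i) (h : ∀ x, (κ x).map i = Measure.dirac x)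
    {β : Type*} [MeasurableSpace β] [MeasurableSingletonClass β] {f : X → β} (hf : Measurable f)
    (x : X) : ∀ᵐ ω ∂(κ x), f (i ω) = f x := by
  have h1 : ∀ᵐ y ∂((κ x).map i), f y = f x := by
    rw [h x]
    exact (ae_dirac_iff (hf (measurableSet_singleton (f x)))).2 rfl
  exact ae_of_ae_map hi.aemeasurable h1

/-- A kernel whose input can be recovered from its output transports densities. -/
lemma comp_withDensity_of_retract (hi : Measurable i)
    (h : ∀ x, (κ x).map i = Measure.dirac x) (μ : Measure X) {f : X → ℝ≥0∞} (hf : Measurable f) :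
    κ ∘ₘ (μ.withDensity f) = (κ ∘ₘ μ).withDensity (f ∘ i) := by
  ext s hs
  rw [Measure.bind_apply hs κ.aemeasurable, withDensity_apply _ hs, ← lintegral_indicator hs,
    Measure.lintegral_bind κ.aemeasurable ((hf.comp hi).indicator hs).aemeasurable,
    lintegral_withDensity_eq_lintegral_mul _ hf (κ.measurable_coe hs)]
  refine lintegral_congr fun x => ?_
  rw [lintegral_indicator hs, Pi.mul_apply]
  have : ∀ᵐ ω ∂((κ x).restrict s), (f ∘ i) ω = f x :=
    ae_restrict_of_ae (ae_comp_eq_of_retract hi h hf x)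
  rw [lintegral_congr_ae this, lintegral_const, Measure.restrict_apply_univ]

lemma rnDeriv_comp_of_retract [IsMarkovKernel κ] (hi : Measurable i)
    (h : ∀ x, (κ x).map i = Measure.dirac x) {μ ν : Measure X} [IsFiniteMeasure μ]
    [IsFiniteMeasure ν] (hμν : μ ≪ ν) :
    (κ ∘ₘ μ).rnDeriv (κ ∘ₘ ν) =ᵐ[κ ∘ₘ ν] (μ.rnDeriv ν) ∘ i := by
  have : κ ∘ₘ μ = (κ ∘ₘ ν).withDensity ((μ.rnDeriv ν) ∘ i) := by
    rw [← comp_withDensity_of_retract hi h ν (Measure.measurable_rnDeriv _ _),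
      Measure.withDensity_rnDeriv_eq _ _ hμν]
  rw [this]
  exact Measure.rnDeriv_withDensity _ ((Measure.measurable_rnDeriv _ _).comp hi)

/-- Data processing applies in both directions: through `κ`, and back through `i`. -/
lemma klDiv_comp_of_retract [IsMarkovKernel κ] (hi : Measurable i)
    (h : ∀ x, (κ x).map i = Measure.dirac x) (μ ν : Measure X) [IsFiniteMeasure μ]
    [IsFiniteMeasure ν] : klDiv (κ ∘ₘ μ) (κ ∘ₘ ν) = klDiv μ ν := by
  refine le_antisymm (klDiv_comp_right_le μ ν κ) ?_
  conv_lhs => rw [← map_comp_of_retract hi h μ, ← map_comp_of_retract hi h ν]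
  exact klDiv_map_le _ _ hi

end Retract

/-! ### Log-likelihood ratios and the two-way factorization -/

section KL

variable {Ω : Type*} [MeasurableSpace Ω]

lemma llr_add_llr {Q R S : Measure Ω} [IsFiniteMeasure Q] [IsFiniteMeasure R] [IsFiniteMeasure S]
    (hQR : Q ≪ R) (hRS : R ≪ S) : llr Q S =ᵐ[Q] llr Q R + llr R S := by
  have h1 := (hQR.trans hRS).ae_le (Measure.rnDeriv_mul_rnDeriv (κ := S) hQR)
  filter_upwards [h1, Measure.rnDeriv_pos hQR, hQR.ae_le (Measure.rnDeriv_pos hRS),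
    hQR.ae_le (Measure.rnDeriv_lt_top Q R), (hQR.trans hRS).ae_le (Measure.rnDeriv_lt_top R S)]
    with ω h h2 h3 h4 h5
  simp only [llr, Pi.add_apply, ← h, Pi.mul_apply, ENNReal.toReal_mul]
  exact Real.log_mul (ENNReal.toReal_pos h2.ne' h4.ne).ne' (ENNReal.toReal_pos h3.ne' h5.ne).ne'

lemma toReal_klDiv_eq_integral_llr {μ ν : Measure Ω} [IsProbabilityMeasure μ]
    [IsProbabilityMeasure ν] (h : μ ≪ ν) : (klDiv μ ν).toReal = ∫ x, llr μ ν x ∂μ :=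
  toReal_klDiv_of_measure_eq h (by simp)

variable {X : Type*} [MeasurableSpace X] {κ : Kernel X Ω} [IsMarkovKernel κ] {i : Ω → X}

/-- Chain rule for the log-likelihood ratio along a kernel with a recoverable input. -/
lemma llr_comp_of_retract (hi : Measurable i)
    (h : ∀ x, (κ x).map i = Measure.dirac x) {Q : Measure Ω} [IsFiniteMeasure Q]
    {ν : Measure X} [IsFiniteMeasure ν] (hQ : Q ≪ κ ∘ₘ ν) :
    Q ≪ κ ∘ₘ (Q.map i) ∧
      llr Q (κ ∘ₘ ν) =ᵐ[Q] llr Q (κ ∘ₘ (Q.map i)) + (llr (Q.map i) ν) ∘ i := by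
  have hν : Q.map i ≪ ν := by
    have := hQ.map hi
    rwa [map_comp_of_retract hi h] at this
  have hk := Measure.measurable_rnDeriv (Q.map i) ν
  have h1 : κ ∘ₘ (Q.map i) = (κ ∘ₘ ν).withDensity (((Q.map i).rnDeriv ν) ∘ i) := by
    rw [← comp_withDensity_of_retract hi h ν hk, Measure.withDensity_rnDeriv_eq _ _ hν]
  -- The density relating the two reference measures is positive `Q`-a.e., so a set null for the
  -- first meets `Q` only in a null set.
  have hpos : ∀ᵐ ω ∂Q, 0 < (Q.map i).rnDeriv ν (i ω) :=
    ae_of_ae_map hi.aemeasurable (Measure.rnDeriv_pos hν)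
  have hac : Q ≪ κ ∘ₘ (Q.map i) := by
    refine Measure.AbsolutelyContinuous.mk fun s hs hs0 => ?_
    rw [h1, withDensity_apply _ hs, lintegral_eq_zero_iff (hk.comp hi)] at hs0
    have h2 : ∀ᵐ ω ∂Q, ω ∈ s → (Q.map i).rnDeriv ν (i ω) = 0 :=
      hQ.ae_le ((ae_restrict_iff' hs).1 hs0)
    have h3 : ∀ᵐ ω ∂Q, ω ∉ s := by
      filter_upwards [h2, hpos] with ω a b c
      exact b.ne' (a c)
    simpa [ae_iff] using h3
  refine ⟨hac, ?_⟩
  have hac2 : κ ∘ₘ (Q.map i) ≪ κ ∘ₘ ν := h1 ▸ withDensity_absolutelyContinuous _ _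
  filter_upwards [llr_add_llr hac hac2, hQ.ae_le (rnDeriv_comp_of_retract hi h hν)] with ω a b
  rw [a]
  simp [llr, b]

/-- Source of the decomposition of EP: expand `llr Q (κ ∘ₘ R.map i)` through `R` and through `κ ∘ₘ
Q.map i`, and compare. Two of the four terms are integrable because `klDiv Q R` is finite, so the
other two are integrable together. -/
lemma integrable_llr_comp_of_retract_iff (hi : Measurable i)
    (h : ∀ x, (κ x).map i = Measure.dirac x) {Q R : Measure Ω} [IsProbabilityMeasure Q]
    [IsProbabilityMeasure R] (hQR : klDiv Q R ≠ ∞) (hR : R ≪ κ ∘ₘ (R.map i)) :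
    (klDiv Q (κ ∘ₘ (Q.map i)) ≠ ∞ ↔ Integrable (llr R (κ ∘ₘ (R.map i))) Q) ∧
    (klDiv Q (κ ∘ₘ (Q.map i)) ≠ ∞ → (klDiv Q (κ ∘ₘ (Q.map i))).toReal =
      (klDiv Q R).toReal - (klDiv (Q.map i) (R.map i)).toReal
        + ∫ ω, llr R (κ ∘ₘ (R.map i)) ω ∂Q) := by
  have : IsProbabilityMeasure (Q.map i) := Measure.isProbabilityMeasure_map hi.aemeasurable
  have : IsProbabilityMeasure (R.map i) := Measure.isProbabilityMeasure_map hi.aemeasurable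
  have hmap : klDiv (Q.map i) (R.map i) ≠ ∞ :=
    ne_top_of_le_ne_top hQR (klDiv_map_le _ _ hi)
  obtain ⟨hm1, hm2⟩ := klDiv_ne_top_iff.1 hmap
  obtain ⟨hq1, hq2⟩ := klDiv_ne_top_iff.1 hQR
  obtain ⟨hac, hllr⟩ := llr_comp_of_retract hi h (hq1.trans hR)
  have hsum := llr_add_llr hq1 hR
  have hm3 : Integrable (llr (Q.map i) (R.map i) ∘ i) Q := hm2.comp_measurable hi
  have hc : llr R (κ ∘ₘ (R.map i)) =ᵐ[Q]
      llr Q (κ ∘ₘ (Q.map i)) + llr (Q.map i) (R.map i) ∘ i - llr Q R := by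
    filter_upwards [hllr, hsum] with ω a b
    simp only [Pi.add_apply, Pi.sub_apply] at *
    linarith
  have hd : llr Q (κ ∘ₘ (Q.map i)) =ᵐ[Q]
      llr R (κ ∘ₘ (R.map i)) - llr (Q.map i) (R.map i) ∘ i + llr Q R := by
    filter_upwards [hc] with ω a
    simp only [Pi.add_apply, Pi.sub_apply] at *
    linarith
  have hiff : klDiv Q (κ ∘ₘ (Q.map i)) ≠ ∞ ↔ Integrable (llr R (κ ∘ₘ (R.map i))) Q := by
    rw [klDiv_ne_top_iff]
    constructor
    · rintro ⟨-, hI⟩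
      exact (integrable_congr hc).2 ((hI.add hm3).sub hq2)
    · intro hI
      exact ⟨hac, (integrable_congr hd).2 ((hI.sub hm3).add hq2)⟩
  refine ⟨hiff, fun hfin => ?_⟩
  have hI := hiff.1 hfin
  rw [toReal_klDiv_eq_integral_llr hac, toReal_klDiv_eq_integral_llr hq1,
    toReal_klDiv_eq_integral_llr hm1, integral_congr_ae hd, integral_add' (hI.sub hm3) hq2,
    integral_sub' hI hm3,
    integral_map hi.aemeasurable (measurable_llr _ _).aestronglyMeasurable]
  simp only [Function.comp]
  ring

/-- Young's inequality: the convex conjugate of `klFun` on the half-line is `exp y - 1`. -/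
lemma mul_le_klFun_add_exp {a : ℝ} (ha : 0 ≤ a) (y : ℝ) : a * y ≤ klFun a + Real.exp y := by
  rcases ha.eq_or_lt with rfl | ha
  · rw [klFun_zero, zero_mul]; positivity
  · have h1 := Real.add_one_le_exp (y - Real.log a)
    rw [Real.exp_sub, Real.exp_log ha, le_div_iff₀ ha] at h1
    rw [klFun_apply]
    nlinarith

end KL

/-! ### Mixtures of extended real values -/

section EReal

lemma ereal_mix_lt_top_iff {a b : ℝ} (ha : 0 < a) (hb : 0 < b) {x y : EReal} (hx : x ≠ ⊥)
    (hy : y ≠ ⊥) : (a : EReal) * x + (b : EReal) * y < ⊤ ↔ x < ⊤ ∧ y < ⊤ := by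
  induction x with
  | bot => exact absurd rfl hx
  | top =>
    induction y with
    | bot => exact absurd rfl hy
    | top => simp [EReal.coe_mul_top_of_pos, ha, hb]
    | coe y => simp [EReal.coe_mul_top_of_pos, ha, ← EReal.coe_mul]
  | coe x =>
    induction y with
    | bot => exact absurd rfl hy
    | top => simp [EReal.coe_mul_top_of_pos, hb, ← EReal.coe_mul]
    | coe y => simp [← EReal.coe_mul, ← EReal.coe_add, EReal.coe_lt_top]

lemma ereal_mix_toReal (a b : ℝ) {x y : EReal} (hx : x ≠ ⊥)
    (hy : y ≠ ⊥) (hx' : x < ⊤) (hy' : y < ⊤) :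
    ((a : EReal) * x + (b : EReal) * y).toReal = a * x.toReal + b * y.toReal := by
  lift x to ℝ using ⟨hx'.ne, hx⟩
  lift y to ℝ using ⟨hy'.ne, hy⟩
  simp [← EReal.coe_mul, ← EReal.coe_add]

end EReal

/-! ### Densities and first-order behaviour of the divergence -/

section Densities

variable {X : Type*} [MeasureSpace X] {p r s : X → ℝ}

lemma isProbabilityMeasure_law (hp : p ∈ densities X) : IsProbabilityMeasure (law p) :=
  ⟨by rw [law, withDensity_apply _ MeasurableSet.univ, Measure.restrict_univ, hp.2.2]⟩

lemma integrable_of_mem_densities (hp : p ∈ densities X) : Integrable p := by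
  refine ⟨hp.1.aestronglyMeasurable, ?_⟩
  rw [hasFiniteIntegral_iff_ofReal (ae_of_all _ hp.2.1), hp.2.2]
  exact ENNReal.one_lt_top

lemma integral_of_mem_densities (hp : p ∈ densities X) : ∫ x, p x = 1 := by
  rw [integral_eq_lintegral_of_nonneg_ae (ae_of_all _ hp.2.1) hp.1.aestronglyMeasurable, hp.2.2,
    ENNReal.toReal_one]

lemma mem_densities_of_integral (hm : Measurable p) (h0 : ∀ x, 0 ≤ p x) (hi : Integrable p)
    (h1 : ∫ x, p x = 1) : p ∈ densities X := by
  refine ⟨hm, h0, ?_⟩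
  rw [← ofReal_integral_eq_lintegral_ofReal hi (ae_of_all _ h0), h1, ENNReal.ofReal_one]

/-- An affine combination of densities is a density as soon as it is nonnegative. -/
lemma affine_mem_densities (hr : r ∈ densities X) (hp : p ∈ densities X) (l : ℝ)
    (h0 : ∀ x, 0 ≤ ((1 - l) • r + l • p) x) : (1 - l) • r + l • p ∈ densities X := by
  have hri := integrable_of_mem_densities hr
  have hpi := integrable_of_mem_densities hp
  refine mem_densities_of_integral ((hr.1.const_smul _).add (hp.1.const_smul _)) h0
    ((hri.smul _).add (hpi.smul _)) ?_
  rw [integral_add' (hri.smul _) (hpi.smul _)]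
  simp only [Pi.smul_apply]
  rw [integral_smul, integral_smul,
    integral_of_mem_densities hr, integral_of_mem_densities hp]
  simp

lemma mix_mem_densities (hr : r ∈ densities X) (hp : p ∈ densities X) {l : ℝ} (hl0 : 0 ≤ l)
    (hl1 : l ≤ 1) : (1 - l) • r + l • p ∈ densities X :=
  affine_mem_densities hr hp l fun x =>
    add_nonneg (mul_nonneg (sub_nonneg.2 hl1) (hr.2.1 x)) (mul_nonneg hl0 (hp.2.1 x))

lemma law_mix (hr : r ∈ densities X) (hp : p ∈ densities X) {l : ℝ} (hl0 : 0 ≤ l)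
    (hl1 : l ≤ 1) : law ((1 - l) • r + l • p)
      = ENNReal.ofReal (1 - l) • law r + ENNReal.ofReal l • law p := by
  have hr' : Measurable fun x => ENNReal.ofReal (r x) := hr.1.ennreal_ofReal
  have hp' : Measurable fun x => ENNReal.ofReal (p x) := hp.1.ennreal_ofReal
  rw [law, law, law, ← withDensity_smul _ hr', ← withDensity_smul _ hp',
    ← withDensity_add_left (hr'.const_smul _)]
  congr 1
  ext x
  simp only [Pi.add_apply, Pi.smul_apply, smul_eq_mul]
  rw [ENNReal.ofReal_add (mul_nonneg (sub_nonneg.2 hl1) (hr.2.1 x)) (mul_nonneg hl0 (hp.2.1 x)),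
    ENNReal.ofReal_mul (sub_nonneg.2 hl1), ENNReal.ofReal_mul hl0]

lemma ae_law_pos (hp : p ∈ densities X) : ∀ᵐ x ∂(law p), 0 < p x := by
  rw [law, ae_withDensity_iff hp.1.ennreal_ofReal]
  exact ae_of_all _ fun x h => by simpa using h

lemma ae_eq_zero_of_ac (hp : p ∈ densities X) (hr : r ∈ densities X) (h : law p ≪ law r) :
    ∀ᵐ x, r x = 0 → p x = 0 := by
  have h1 : ∀ᵐ x ∂(law p), 0 < r x := h.ae_le (ae_law_pos hr)
  rw [law, ae_withDensity_iff hp.1.ennreal_ofReal] at h1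
  filter_upwards [h1] with x hx h0
  by_contra hne
  have := hx (by simpa using lt_of_le_of_ne (hp.2.1 x) (Ne.symm hne))
  exact this.ne' h0

lemma law_eq_withDensity_div (hp : p ∈ densities X) (hr : r ∈ densities X)
    (h : law p ≪ law r) :
    law p = (law r).withDensity fun x => ENNReal.ofReal (p x / r x) := by
  have hd : Measurable fun x => p x / r x := hp.1.div hr.1
  rw [law, law, ← withDensity_mul _ hr.1.ennreal_ofReal hd.ennreal_ofReal]
  refine withDensity_congr_ae ?_
  filter_upwards [ae_eq_zero_of_ac hp hr h] with x hx
  rw [Pi.mul_apply, ← ENNReal.ofReal_mul (hr.2.1 x)]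
  by_cases h0 : r x = 0
  · simp [h0, hx h0]
  · rw [mul_div_cancel₀ _ h0]

lemma rnDeriv_law (hp : p ∈ densities X) (hr : r ∈ densities X) (h : law p ≪ law r) :
    (fun x => ((law p).rnDeriv (law r) x).toReal) =ᵐ[law r] fun x => p x / r x := by
  have := isProbabilityMeasure_law hr
  have hd : Measurable fun x => p x / r x := hp.1.div hr.1
  have h1 := Measure.rnDeriv_withDensity (law r) hd.ennreal_ofReal
  rw [← law_eq_withDensity_div hp hr h] at h1
  filter_upwards [h1] with x hx
  rw [hx, ENNReal.toReal_ofReal (div_nonneg (hp.2.1 x) (hr.2.1 x))]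

lemma D_ne_top_iff (hp : p ∈ densities X) (hr : r ∈ densities X) (h : law p ≪ law r) :
    D p r ≠ ∞ ↔ Integrable (fun x => klFun (p x / r x)) (law r) := by
  have := isProbabilityMeasure_law hr
  have := isProbabilityMeasure_law hp
  rw [D, klDiv_ne_top_iff, and_iff_right h, ← integrable_klFun_rnDeriv_iff h]
  refine integrable_congr ?_
  filter_upwards [rnDeriv_law hp hr h] with x hx
  rw [hx]

lemma toReal_D (hp : p ∈ densities X) (hr : r ∈ densities X) (h : law p ≪ law r) :
    (D p r).toReal = ∫ x, klFun (p x / r x) ∂(law r) := by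
  have := isProbabilityMeasure_law hr
  have := isProbabilityMeasure_law hp
  rw [D, toReal_klDiv_eq_integral_klFun h]
  refine integral_congr_ae ?_
  filter_upwards [rnDeriv_law hp hr h] with x hx
  rw [hx]

lemma law_le_smul_of_le_mul {C : ℝ} (hC : 0 ≤ C) (h : ∀ x, p x ≤ C * r x) :
    law p ≤ ENNReal.ofReal C • law r := by
  rw [law, law, ← withDensity_smul' _ _ ENNReal.ofReal_ne_top]
  refine withDensity_mono (ae_of_all _ fun x => ?_)
  rw [Pi.smul_apply, smul_eq_mul, ← ENNReal.ofReal_mul hC]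
  exact ENNReal.ofReal_le_ofReal (h x)

lemma law_ac_of_le_mul {C : ℝ} (hC : 0 ≤ C) (h : ∀ x, p x ≤ C * r x) : law p ≪ law r :=
  Measure.absolutelyContinuous_of_le_smul (law_le_smul_of_le_mul hC h)

/-- The density ratio takes values in `[0, C]`, on which the continuous function `klFun` is bounded.
-/
lemma D_ne_top_of_le_mul (hp : p ∈ densities X) (hr : r ∈ densities X) {C : ℝ} (hC : 0 ≤ C)
    (h : ∀ x, p x ≤ C * r x) : D p r ≠ ∞ := by
  have := isProbabilityMeasure_law hr
  rw [D_ne_top_iff hp hr (law_ac_of_le_mul hC h)]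
  obtain ⟨M, hM⟩ := (isCompact_Icc (a := 0) (b := C)).exists_bound_of_continuousOn
    continuous_klFun.continuousOn
  refine Integrable.of_bound
    (measurable_klFun.comp (hp.1.div hr.1)).aestronglyMeasurable M (ae_of_all _ fun x => ?_)
  refine hM _ ⟨div_nonneg (hp.2.1 x) (hr.2.1 x), ?_⟩
  rcases (hr.2.1 x).eq_or_lt with h0 | h0
  · simp [← h0, hC]
  · exact (div_le_iff₀ h0).2 (h x)

/-- Convexity together with `klFun 1 = 0`. It provides the dominating function for the limit `l →
0`. -/
lemma klFun_mix_le {a : ℝ} (ha : 0 ≤ a) {l : ℝ} (hl0 : 0 ≤ l) (hl1 : l ≤ 1) :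
    klFun (1 - l + l * a) ≤ l * klFun a := by
  have := convexOn_klFun.2 (x := 1) (by simp) (y := a) ha (sub_nonneg.2 hl1) hl0 (by ring)
  simpa [klFun_one] using this

/-- `klFun` and its derivative both vanish at `1`. -/
lemma tendsto_klFun_mix_div (a : ℝ) :
    Tendsto (fun l : ℝ => l⁻¹ * klFun (1 - l + l * a)) (𝓝[>] 0) (𝓝 0) := by
  have h1 : HasDerivAt klFun (Real.log 1) (1 - (0 : ℝ) + 0 * a) := by
    simpa using hasDerivAt_klFun one_ne_zero
  have h2 : HasDerivAt (fun l : ℝ => 1 - l + l * a) (-1 + 1 * a) 0 :=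
    ((hasDerivAt_id (0 : ℝ)).const_sub 1).add ((hasDerivAt_id (0 : ℝ)).mul_const a)
  have h3 := (h1.comp (0 : ℝ) h2).tendsto_slope_zero_right
  simpa [klFun_one] using h3

lemma D_mix (hr : r ∈ densities X) (hp : p ∈ densities X) (hpr : D p r ≠ ∞) {l : ℝ}
    (hl0 : 0 ≤ l) (hl1 : l ≤ 1) : D ((1 - l) • r + l • p) r ≠ ∞ ∧
      (D ((1 - l) • r + l • p) r).toReal = ∫ x, klFun (1 - l + l * (p x / r x)) ∂(law r) := by
  have := isProbabilityMeasure_law hr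
  have := isProbabilityMeasure_law hp
  have hac := (klDiv_ne_top_iff.1 hpr).1
  have hm := mix_mem_densities hr hp hl0 hl1
  have hac' : law ((1 - l) • r + l • p) ≪ law r := by
    rw [law_mix hr hp hl0 hl1]
    exact (Measure.smul_absolutelyContinuous.trans .rfl).add_left
      (Measure.smul_absolutelyContinuous.trans hac)
  have heq : (fun x => klFun (((1 - l) • r + l • p) x / r x)) =ᵐ[law r]
      fun x => klFun (1 - l + l * (p x / r x)) := by
    filter_upwards [ae_law_pos hr] with x hx
    congr 1
    simp only [Pi.add_apply, Pi.smul_apply, smul_eq_mul]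
    field_simp
  refine ⟨(D_ne_top_iff hm hr hac').2 ((integrable_congr heq).2 ?_), ?_⟩
  · refine Integrable.mono' (((D_ne_top_iff hp hr hac).1 hpr).const_mul l)
      (measurable_klFun.comp
        (((hp.1.div hr.1).const_mul l).const_add (1 - l))).aestronglyMeasurable
      (ae_of_all _ fun x => ?_)
    have h0 : 0 ≤ p x / r x := div_nonneg (hp.2.1 x) (hr.2.1 x)
    rw [Real.norm_of_nonneg (klFun_nonneg (by nlinarith [mul_nonneg hl0 h0]))]
    exact klFun_mix_le h0 hl0 hl1
  · rw [toReal_D hm hr hac', integral_congr_ae heq]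

/-- The divergence from `r` vanishes to first order along the segment from `r` to `p`. -/
lemma tendsto_D_mix_div (hr : r ∈ densities X) (hp : p ∈ densities X) (hpr : D p r ≠ ∞) :
    Tendsto (fun l : ℝ => l⁻¹ * (D ((1 - l) • r + l • p) r).toReal) (𝓝[>] 0) (𝓝 0) := by
  have := isProbabilityMeasure_law hr
  have := isProbabilityMeasure_law hp
  have hac := (klDiv_ne_top_iff.1 hpr).1
  have hev : ∀ᶠ l : ℝ in 𝓝[>] 0, 0 < l ∧ l < 1 :=
    Ioo_mem_nhdsGT one_pos
  have h1 : Tendsto (fun l : ℝ => ∫ x, l⁻¹ * klFun (1 - l + l * (p x / r x)) ∂(law r))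
      (𝓝[>] 0) (𝓝 (∫ _, 0 ∂(law r))) := by
    refine tendsto_integral_filter_of_dominated_convergence (fun x => klFun (p x / r x)) ?_ ?_
      ((D_ne_top_iff hp hr hac).1 hpr) (ae_of_all _ fun x => tendsto_klFun_mix_div _)
    · exact Eventually.of_forall fun l => ((measurable_klFun.comp
        (((hp.1.div hr.1).const_mul l).const_add (1 - l))).const_mul _).aestronglyMeasurable
    · filter_upwards [hev] with l hl
      refine ae_of_all _ fun x => ?_
      have h0 : 0 ≤ p x / r x := div_nonneg (hp.2.1 x) (hr.2.1 x)
      have h2 : 0 ≤ klFun (1 - l + l * (p x / r x)) :=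
        klFun_nonneg (by nlinarith [mul_nonneg hl.1.le h0])
      rw [Real.norm_of_nonneg (mul_nonneg (inv_nonneg.2 hl.1.le) h2), inv_mul_le_iff₀ hl.1]
      exact klFun_mix_le h0 hl.1.le hl.2.le
  rw [integral_zero] at h1
  refine h1.congr' ?_
  filter_upwards [hev] with l hl
  rw [(D_mix hr hp hpr hl.1.le hl.2.le).2, integral_const_mul]

end Densities

/-! ### Entropy production of a pair of kernels and first-order optimality -/

section KernelEP

/-- A forward kernel `A` and a backward kernel `B` into a path space `Ω`, such that the input of
`A` is recovered by `i` and the input of `B` is recovered by `j`. -/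
structure IsProtocol {X Ω : Type*} [MeasurableSpace X] [MeasurableSpace Ω]
    (A B : Kernel X Ω) (i j : Ω → X) : Prop where
  markov_fwd : IsMarkovKernel A
  markov_bwd : IsMarkovKernel B
  measurable_init : Measurable i
  measurable_final : Measurable j
  map_init : ∀ x, (A x).map i = Measure.dirac x
  map_final : ∀ x, (B x).map j = Measure.dirac x

variable {X Ω : Type*} [MeasureSpace X] [MeasurableSpace Ω]

/-- The law of the final state. -/
noncomputable def kernelFinalLaw (A : Kernel X Ω) (j : Ω → X) (p : X → ℝ) : Measure X :=
  (A ∘ₘ law p).map j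

/-- Entropy production in terms of a forward and a backward kernel. -/
noncomputable def kernelEP (A B : Kernel X Ω) (j : Ω → X) (G : (X → ℝ) → EReal) (p : X → ℝ) :
    EReal :=
  (klDiv (A ∘ₘ law p) (B ∘ₘ kernelFinalLaw A j p) : EReal) + G p

/-- The stochastic entropy production of the process started in `r`. -/
noncomputable def pathEP (A B : Kernel X Ω) (j : Ω → X) (r : X → ℝ) : Ω → ℝ :=
  llr (A ∘ₘ law r) (B ∘ₘ kernelFinalLaw A j r)

/-- The part of the entropy production that is linear in the initial density: the expected
stochastic entropy production of the process started in `r`, plus `G`. -/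
noncomputable def linearEP (A B : Kernel X Ω) (j : Ω → X) (G : (X → ℝ) → EReal) (r p : X → ℝ) :
    ℝ :=
  ∫ ω, pathEP A B j r ω ∂(A ∘ₘ law p) + (G p).toReal

variable {A B : Kernel X Ω} {i j : Ω → X} {G : (X → ℝ) → EReal} {p r s : X → ℝ}

lemma IsProtocol.isProbabilityMeasure (hW : IsProtocol A B i j) (hp : p ∈ densities X) :
    IsProbabilityMeasure (A ∘ₘ law p) := by
  have := hW.markov_fwd
  have := isProbabilityMeasure_law hp
  infer_instance

lemma IsProtocol.klDiv_fwd (hW : IsProtocol A B i j) (hp : p ∈ densities X)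
    (hr : r ∈ densities X) : klDiv (A ∘ₘ law p) (A ∘ₘ law r) = D p r := by
  have := hW.markov_fwd
  have := isProbabilityMeasure_law hp
  have := isProbabilityMeasure_law hr
  exact klDiv_comp_of_retract hW.measurable_init hW.map_init _ _

lemma IsProtocol.klDiv_final_le (hW : IsProtocol A B i j) (hp : p ∈ densities X)
    (hr : r ∈ densities X) :
    klDiv (kernelFinalLaw A j p) (kernelFinalLaw A j r) ≤ D p r := by
  have := hW.isProbabilityMeasure hp
  have := hW.isProbabilityMeasure hr
  rw [← hW.klDiv_fwd hp hr]
  exact klDiv_map_le _ _ hW.measurable_final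

lemma kernelEP_lt_top_iff (hG : IsLSCLinear G) (hp : p ∈ densities X) :
    kernelEP A B j G p < ⊤ ↔
      klDiv (A ∘ₘ law p) (B ∘ₘ kernelFinalLaw A j p) ≠ ∞ ∧ G p < ⊤ := by
  rw [kernelEP, lt_top_iff_ne_top, lt_top_iff_ne_top,
    EReal.add_ne_top_iff_ne_top₂ (EReal.coe_ennreal_ne_bot _) (hG.ne_bot p hp), ne_eq, ne_eq,
    EReal.coe_ennreal_eq_top_iff]

lemma IsProtocol.ac_of_lt_top (hW : IsProtocol A B i j) (hG : IsLSCLinear G)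
    (hr : r ∈ densities X) (hrfin : kernelEP A B j G r < ⊤) :
    A ∘ₘ law r ≪ B ∘ₘ kernelFinalLaw A j r := by
  have := hW.markov_bwd
  have := hW.isProbabilityMeasure hr
  have : IsProbabilityMeasure (kernelFinalLaw A j r) :=
    Measure.isProbabilityMeasure_map hW.measurable_final.aemeasurable
  exact (klDiv_ne_top_iff.1 ((kernelEP_lt_top_iff hG hr).1 hrfin).1).1

lemma IsProtocol.kernelEP_lt_top_iff_integrable (hW : IsProtocol A B i j) (hG : IsLSCLinear G)
    (hr : r ∈ densities X) (hrfin : kernelEP A B j G r < ⊤) (hp : p ∈ densities X)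
    (hpr : D p r ≠ ∞) :
    kernelEP A B j G p < ⊤ ↔ Integrable (pathEP A B j r) (A ∘ₘ law p) ∧ G p < ⊤ := by
  have := hW.markov_bwd
  have := hW.isProbabilityMeasure hr
  have := hW.isProbabilityMeasure hp
  rw [kernelEP_lt_top_iff hG hp]
  rw [← hW.klDiv_fwd hp hr] at hpr
  exact and_congr_left' (integrable_llr_comp_of_retract_iff hW.measurable_final hW.map_final hpr
    (hW.ac_of_lt_top hG hr hrfin)).1

/-- The entropy production is the difference of two divergences from `r` plus a linear term. -/
lemma IsProtocol.kernelEP_eq (hW : IsProtocol A B i j) (hG : IsLSCLinear G)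
    (hr : r ∈ densities X) (hrfin : kernelEP A B j G r < ⊤) (hp : p ∈ densities X)
    (hpr : D p r ≠ ∞) (hpfin : kernelEP A B j G p < ⊤) :
    kernelEP A B j G p = (((D p r).toReal
      - (klDiv (kernelFinalLaw A j p) (kernelFinalLaw A j r)).toReal
      + linearEP A B j G r p : ℝ) : EReal) := by
  have := hW.markov_bwd
  have := hW.isProbabilityMeasure hr
  have := hW.isProbabilityMeasure hp
  obtain ⟨hfin, hGp⟩ := (kernelEP_lt_top_iff hG hp).1 hpfin
  have hpr' := hpr
  rw [← hW.klDiv_fwd hp hr] at hpr'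
  have h := (integrable_llr_comp_of_retract_iff hW.measurable_final hW.map_final hpr'
    (hW.ac_of_lt_top hG hr hrfin)).2 hfin
  rw [kernelEP, ← EReal.coe_toReal hGp.ne (hG.ne_bot p hp), ← EReal.coe_ennreal_toReal hfin,
    ← EReal.coe_add, EReal.coe_eq_coe_iff]
  refine (congrArg (· + (G p).toReal) h).trans ?_
  rw [hW.klDiv_fwd hp hr]
  exact add_assoc _ _ _

lemma IsProtocol.kernelEP_self (hW : IsProtocol A B i j) (hG : IsLSCLinear G)
    (hr : r ∈ densities X) (hrfin : kernelEP A B j G r < ⊤) :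
    kernelEP A B j G r = (linearEP A B j G r r : ℝ) := by
  have := hW.isProbabilityMeasure hr
  have := isProbabilityMeasure_law hr
  have : IsProbabilityMeasure (kernelFinalLaw A j r) :=
    Measure.isProbabilityMeasure_map hW.measurable_final.aemeasurable
  have h0 : D r r = 0 := klDiv_self _
  rw [hW.kernelEP_eq hG hr hrfin hr (by simp [h0]) hrfin, h0, klDiv_self]
  simp

/-- The excess entropy production over `r` is the drop of the divergence from `r` plus the
difference of the linear parts. -/
lemma IsProtocol.kernelEP_sub_eq (hW : IsProtocol A B i j) (hG : IsLSCLinear G)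
    (hr : r ∈ densities X) (hrfin : kernelEP A B j G r < ⊤) (hp : p ∈ densities X)
    (hpr : D p r ≠ ∞) (hpfin : kernelEP A B j G p < ⊤) :
    kernelEP A B j G p - kernelEP A B j G r = (D p r : EReal)
      - (klDiv (kernelFinalLaw A j p) (kernelFinalLaw A j r) : EReal)
      + ((linearEP A B j G r p - linearEP A B j G r r : ℝ) : EReal) := by
  have hT : klDiv (kernelFinalLaw A j p) (kernelFinalLaw A j r) ≠ ∞ :=
    ne_top_of_le_ne_top hpr (hW.klDiv_final_le hp hr)
  rw [hW.kernelEP_eq hG hr hrfin hp hpr hpfin, hW.kernelEP_self hG hr hrfin,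
    ← EReal.coe_ennreal_toReal hpr, ← EReal.coe_ennreal_toReal hT, ← EReal.coe_sub,
    ← EReal.coe_sub, ← EReal.coe_add]
  congr 1
  ring

lemma comp_law_mix (hr : r ∈ densities X) (hp : p ∈ densities X) {l : ℝ} (hl0 : 0 ≤ l)
    (hl1 : l ≤ 1) : A ∘ₘ law ((1 - l) • r + l • p)
      = ENNReal.ofReal (1 - l) • (A ∘ₘ law r) + ENNReal.ofReal l • (A ∘ₘ law p) := by
  rw [law_mix hr hp hl0 hl1, Measure.comp_add, Measure.comp_smul, Measure.comp_smul]

lemma integrable_comp_law_mix_iff (hr : r ∈ densities X) (hp : p ∈ densities X) {l : ℝ}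
    (hl0 : 0 < l) (hl1 : l < 1) {c : Ω → ℝ} :
    Integrable c (A ∘ₘ law ((1 - l) • r + l • p)) ↔
      Integrable c (A ∘ₘ law r) ∧ Integrable c (A ∘ₘ law p) := by
  rw [comp_law_mix hr hp hl0.le hl1.le, integrable_add_measure,
    integrable_smul_measure (by simpa using hl1) ENNReal.ofReal_ne_top,
    integrable_smul_measure (by simpa using hl0) ENNReal.ofReal_ne_top]

lemma IsLSCLinear.mix_lt_top_iff (hG : IsLSCLinear G) (hr : r ∈ densities X)
    (hp : p ∈ densities X) {l : ℝ} (hl0 : 0 < l) (hl1 : l < 1) :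
    G ((1 - l) • r + l • p) < ⊤ ↔ G r < ⊤ ∧ G p < ⊤ := by
  rw [hG.mix p hp r hr l hl0 hl1]
  exact ereal_mix_lt_top_iff (sub_pos.2 hl1) hl0 (hG.ne_bot r hr) (hG.ne_bot p hp)

/-- The integrability and finiteness hypotheses exclude the default values of the integral and of
`toReal`, for which additivity could fail. -/
lemma linearEP_mix (hG : IsLSCLinear G) {t : X → ℝ} (hr : r ∈ densities X)
    (hp : p ∈ densities X) {l : ℝ} (hl0 : 0 < l) (hl1 : l < 1)
    (hri : Integrable (pathEP A B j t) (A ∘ₘ law r))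
    (hpi : Integrable (pathEP A B j t) (A ∘ₘ law p)) (hGr : G r < ⊤) (hGp : G p < ⊤) :
    linearEP A B j G t ((1 - l) • r + l • p)
      = (1 - l) * linearEP A B j G t r + l * linearEP A B j G t p := by
  rw [linearEP, hG.mix p hp r hr l hl0 hl1, comp_law_mix hr hp hl0.le hl1.le,
    integral_add_measure (hri.smul_measure ENNReal.ofReal_ne_top)
      (hpi.smul_measure ENNReal.ofReal_ne_top), integral_smul_measure, integral_smul_measure,
    ENNReal.toReal_ofReal (sub_pos.2 hl1).le, ENNReal.toReal_ofReal hl0.le,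
    ereal_mix_toReal _ _ (hG.ne_bot r hr) (hG.ne_bot p hp) hGr hGp, linearEP, linearEP,
    smul_eq_mul, smul_eq_mul]
  ring

/-- First-order optimality: the linear part does not decrease along a segment from `r` on which
`r` is minimal. -/
lemma IsProtocol.linearEP_le (hW : IsProtocol A B i j) (hG : IsLSCLinear G)
    (hr : r ∈ densities X) (hrfin : kernelEP A B j G r < ⊤) (hp : p ∈ densities X)
    (hpr : D p r ≠ ∞) (hpfin : kernelEP A B j G p < ⊤)
    (hmin : ∀ l : ℝ, 0 < l → l < 1 →
      kernelEP A B j G r ≤ kernelEP A B j G ((1 - l) • r + l • p)) :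
    linearEP A B j G r r ≤ linearEP A B j G r p := by
  have := isProbabilityMeasure_law hr
  have h0 : D r r ≠ ∞ := by rw [D, klDiv_self]; exact ENNReal.zero_ne_top
  obtain ⟨hri, hGr⟩ := (hW.kernelEP_lt_top_iff_integrable hG hr hrfin hr h0).1 hrfin
  obtain ⟨hpi, hGp⟩ := (hW.kernelEP_lt_top_iff_integrable hG hr hrfin hp hpr).1 hpfin
  have key : ∀ l : ℝ, 0 < l → l < 1 → linearEP A B j G r r - linearEP A B j G r p
      ≤ l⁻¹ * (D ((1 - l) • r + l • p) r).toReal := by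
    intro l hl0 hl1
    have hm := mix_mem_densities hr hp hl0.le hl1.le
    have hD := (D_mix hr hp hpr hl0.le hl1.le).1
    have hfin := (hW.kernelEP_lt_top_iff_integrable hG hr hrfin hm hD).2
      ⟨(integrable_comp_law_mix_iff hr hp hl0 hl1).2 ⟨hri, hpi⟩,
        (hG.mix_lt_top_iff hr hp hl0 hl1).2 ⟨hGr, hGp⟩⟩
    have h := hmin l hl0 hl1
    rw [hW.kernelEP_eq hG hr hrfin hm hD hfin, hW.kernelEP_self hG hr hrfin,
      EReal.coe_le_coe_iff, linearEP_mix hG hr hp hl0 hl1 hri hpi hGr hGp] at h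
    -- The final divergence enters with a minus sign, so it may be dropped.
    have hT := ENNReal.toReal_nonneg (a := klDiv
      (kernelFinalLaw A j ((1 - l) • r + l • p)) (kernelFinalLaw A j r))
    rw [le_inv_mul_iff₀ hl0]
    linarith
  have hlim := ge_of_tendsto (tendsto_D_mix_div hr hp hpr)
    (by filter_upwards [Ioo_mem_nhdsGT (one_pos (α := ℝ))] with l hl using key l hl.1 hl.2)
  linarith

/-- If the segment from `p` to `r` can be prolonged beyond the minimizer `r`, then `p` has finite
entropy production and the same linear part as `r`. -/
lemma IsProtocol.linearEP_eq_of_prolong (hW : IsProtocol A B i j) (hG : IsLSCLinear G)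
    (hr : r ∈ densities X) (hrfin : kernelEP A B j G r < ⊤) (hp : p ∈ densities X)
    {l : ℝ} (hl : l < 0) (hs : (1 - l) • r + l • p ∈ densities X)
    (hmin : ∀ q ∈ ({p, (1 - l) • r + l • p} : Set (X → ℝ)), ∀ l : ℝ, 0 < l → l < 1 →
      kernelEP A B j G r ≤ kernelEP A B j G ((1 - l) • r + l • q)) :
    D p r ≠ ∞ ∧ kernelEP A B j G p < ⊤ ∧ linearEP A B j G r p = linearEP A B j G r r := by
  have := isProbabilityMeasure_law hr
  have h0 : D r r ≠ ∞ := by rw [D, klDiv_self]; exact ENNReal.zero_ne_top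
  set s := (1 - l) • r + l • p
  have hsx : ∀ x, s x = (1 - l) * r x + l * p x := fun x => rfl
  clear_value s
  have h1l : 0 < 1 - l := by linarith
  -- Obtained by solving `s = (1 - l) r + l p` for `r`, which is then a proper mixture of `s` and
  -- `p`.
  set m : ℝ := -l / (1 - l) with hm
  have hm0 : 0 < m := div_pos (by linarith) h1l
  have hm1 : m < 1 := (div_lt_one h1l).2 (by linarith)
  have hmix : r = (1 - m) • s + m • p := by
    ext x
    simp only [Pi.add_apply, Pi.smul_apply, smul_eq_mul, hsx, hm]
    field_simp
    ring
  clear_value m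
  have hDs : D s r ≠ ∞ := D_ne_top_of_le_mul hs hr h1l.le fun x => by
    have := mul_nonpos_of_nonpos_of_nonneg hl.le (hp.2.1 x)
    rw [hsx]; linarith
  have hDp : D p r ≠ ∞ := D_ne_top_of_le_mul hp hr (inv_nonneg.2 hm0.le) fun x => by
    rw [le_inv_mul_iff₀ hm0, show r x = (1 - m) * s x + m * p x from congrFun hmix x]
    have := mul_nonneg (sub_pos.2 hm1).le (hs.2.1 x)
    linarith
  obtain ⟨hri, hGr⟩ := (hW.kernelEP_lt_top_iff_integrable hG hr hrfin hr h0).1 hrfin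
  have hri' : Integrable (pathEP A B j r) (A ∘ₘ law ((1 - m) • s + m • p)) := by
    rw [← hmix]; exact hri
  have hGr' := hGr
  rw [hmix] at hGr'
  obtain ⟨hGs, hGp⟩ := (hG.mix_lt_top_iff hs hp hm0 hm1).1 hGr'
  obtain ⟨hsi, hpi⟩ := (integrable_comp_law_mix_iff hs hp hm0 hm1).1 hri'
  have hsfin := (hW.kernelEP_lt_top_iff_integrable hG hr hrfin hs hDs).2 ⟨hsi, hGs⟩
  have hpfin := (hW.kernelEP_lt_top_iff_integrable hG hr hrfin hp hDp).2 ⟨hpi, hGp⟩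
  have h1 := hW.linearEP_le hG hr hrfin hs hDs hsfin (hmin s (by simp))
  have h2 := hW.linearEP_le hG hr hrfin hp hDp hpfin (hmin p (by simp))
  have h3 := linearEP_mix (t := r) hG hs hp hm0 hm1 hsi hpi hGs hGp
  rw [← hmix] at h3
  have h4 := mul_le_mul_of_nonneg_left h1 (sub_pos.2 hm1).le
  -- Since `L(r) = (1 - m) L(s) + m L(p)` and `L(s) ≥ L(r)`, it follows that `m L(p) ≤ m L(r)`.
  exact ⟨hDp, hpfin, le_antisymm (le_of_mul_le_mul_left (by linarith) hm0) h2⟩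

end KernelEP

/-! ### Truncation at multiples of the minimizer -/

section Truncation

/-- Truncating a nonnegative weight `H` at height `k`: if the weighted integrals of `c` stay bounded
above and the negative part of `c` is integrable against `H`, then so is `c`, and the weighted
integrals converge. -/
lemma integrable_and_tendsto_of_truncation {Ω : Type*} [MeasurableSpace Ω] {Q : Measure Ω}
    {H c : Ω → ℝ} (hH : Measurable H) (hH0 : ∀ ω, 0 ≤ H ω) (hc : Measurable c)
    (hneg : Integrable (fun ω => H ω * max (-c ω) 0) Q) {M : ℝ}
    (hM : ∀ᶠ k : ℕ in atTop, Integrable (fun ω => min (H ω) k * c ω) Q ∧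
      ∫ ω, min (H ω) k * c ω ∂Q ≤ M) :
    Integrable (fun ω => H ω * c ω) Q ∧
      Tendsto (fun k : ℕ => ∫ ω, min (H ω) k * c ω ∂Q) atTop (𝓝 (∫ ω, H ω * c ω ∂Q)) := by
  have hmin0 : ∀ (k : ℕ) ω, 0 ≤ min (H ω) k := fun k ω => le_min (hH0 ω) k.cast_nonneg
  have hmax : ∀ ω, max (c ω) 0 = c ω + max (-c ω) 0 := fun ω => by
    rcases le_total (c ω) 0 with h | h
    · rw [max_eq_right h, max_eq_left (by linarith)]; ring
    · rw [max_eq_left h, max_eq_right (by linarith)]; ring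
  have hmk : ∀ k : ℕ, Measurable fun ω => min (H ω) k := fun k => hH.min measurable_const
  have hev : ∀ ω, ∀ᶠ k : ℕ in atTop, min (H ω) k = H ω := fun ω => by
    obtain ⟨N, hN⟩ := exists_nat_ge (H ω)
    filter_upwards [eventually_ge_atTop N] with k hk
    exact min_eq_left (hN.trans (Nat.cast_le.2 hk))
  have hnegk : ∀ k : ℕ, Integrable (fun ω => min (H ω) k * max (-c ω) 0) Q := fun k => by
    refine hneg.mono' ((hmk k).mul (hc.neg.max measurable_const)).aestronglyMeasurable
      (ae_of_all _ fun ω => ?_)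
    rw [Real.norm_of_nonneg (mul_nonneg (hmin0 k ω) (le_max_right _ _))]
    exact mul_le_mul_of_nonneg_right (min_le_left _ _) (le_max_right _ _)
  have hlim : Tendsto (fun k : ℕ => ∫⁻ ω, ENNReal.ofReal (min (H ω) k * max (c ω) 0) ∂Q) atTop
      (𝓝 (∫⁻ ω, ENNReal.ofReal (H ω * max (c ω) 0) ∂Q)) := by
    refine lintegral_tendsto_of_tendsto_of_monotone
      (fun k => ((hmk k).mul (hc.max measurable_const)).ennreal_ofReal.aemeasurable)
      (ae_of_all _ fun ω => ?_) (ae_of_all _ fun ω => ?_)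
    · intro k l hkl
      exact ENNReal.ofReal_le_ofReal (mul_le_mul_of_nonneg_right
        (min_le_min_left _ (Nat.cast_le.2 hkl)) (le_max_right _ _))
    · exact tendsto_const_nhds.congr' ((hev ω).mono fun k hk => by simp only [hk])
  -- Monotone convergence for the positive part, whose truncated integrals are at most `M` plus the
  -- integral of the negative part.
  have hpos : Integrable (fun ω => H ω * max (c ω) 0) Q := by
    refine ⟨(hH.mul (hc.max measurable_const)).aestronglyMeasurable, ?_⟩
    rw [hasFiniteIntegral_iff_ofReal
      (ae_of_all _ fun ω => mul_nonneg (hH0 ω) (le_max_right _ _))]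
    refine lt_of_le_of_lt (le_of_tendsto hlim (b := ENNReal.ofReal
      (M + ∫ ω, H ω * max (-c ω) 0 ∂Q)) ?_) ENNReal.ofReal_lt_top
    filter_upwards [hM] with k hk
    have heq : (fun ω => min (H ω) k * max (c ω) 0)
        = fun ω => min (H ω) k * c ω + min (H ω) k * max (-c ω) 0 := by
      ext ω; rw [hmax]; ring
    have hI : Integrable (fun ω => min (H ω) k * max (c ω) 0) Q := heq ▸ hk.1.add (hnegk k)
    rw [← ofReal_integral_eq_lintegral_ofReal hI
      (ae_of_all _ fun ω => mul_nonneg (hmin0 k ω) (le_max_right _ _))]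
    refine ENNReal.ofReal_le_ofReal ?_
    rw [heq, integral_add hk.1 (hnegk k)]
    refine add_le_add hk.2 (integral_mono (hnegk k) hneg fun ω => ?_)
    exact mul_le_mul_of_nonneg_right (min_le_left _ _) (le_max_right _ _)
  have hI : Integrable (fun ω => H ω * c ω) Q := by
    refine (hpos.sub hneg).congr (ae_of_all _ fun ω => ?_)
    simp only [Pi.sub_apply, hmax]
    ring
  refine ⟨hI, tendsto_integral_of_dominated_convergence (fun ω => ‖H ω * c ω‖)
    (fun k => ((hmk k).mul hc).aestronglyMeasurable) hI.norm (fun k => ae_of_all _ fun ω => ?_)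
    (ae_of_all _ fun ω => ?_)⟩
  · rw [norm_mul, norm_mul, Real.norm_of_nonneg (hmin0 k ω), Real.norm_of_nonneg (hH0 ω)]
    exact mul_le_mul_of_nonneg_right (min_le_left _ _) (norm_nonneg _)
  · exact tendsto_const_nhds.congr' ((hev ω).mono fun k hk => by simp only [hk])

variable {X : Type*} [MeasureSpace X] {p r : X → ℝ}

/-- The mass of the truncation of `p` at `k` times `r`. -/
noncomputable def truncMass (p r : X → ℝ) (k : ℕ) : ℝ := ∫ x, min (p x) (k * r x)

/-- The normalized truncation of `p` at `k` times `r`. -/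
noncomputable def trunc (p r : X → ℝ) (k : ℕ) (x : X) : ℝ :=
  (truncMass p r k)⁻¹ * min (p x) (k * r x)

lemma min_mul_nonneg (hp : p ∈ densities X) (hr : r ∈ densities X) (k : ℕ) (x : X) :
    0 ≤ min (p x) (k * r x) :=
  le_min (hp.2.1 x) (mul_nonneg k.cast_nonneg (hr.2.1 x))

lemma measurable_min_mul (hp : p ∈ densities X) (hr : r ∈ densities X) (k : ℕ) :
    Measurable fun x => min (p x) (k * r x) :=
  hp.1.min (hr.1.const_mul _)

lemma tendsto_min_mul (hp : p ∈ densities X) (hr : r ∈ densities X) (h : law p ≪ law r) :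
    ∀ᵐ x, Tendsto (fun k : ℕ => min (p x) (k * r x)) atTop (𝓝 (p x)) := by
  filter_upwards [ae_eq_zero_of_ac hp hr h] with x hx
  refine tendsto_const_nhds.congr' ?_
  rcases (hr.2.1 x).eq_or_lt with h0 | h0
  · exact Eventually.of_forall fun k => by simp [hx h0.symm, ← h0]
  · obtain ⟨N, hN⟩ := exists_nat_ge (p x / r x)
    filter_upwards [eventually_ge_atTop N] with k hk
    rw [min_eq_left]
    exact (div_le_iff₀ h0).1 (hN.trans (Nat.cast_le.2 hk))

lemma tendsto_truncMass (hp : p ∈ densities X) (hr : r ∈ densities X) (h : law p ≪ law r) :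
    Tendsto (truncMass p r) atTop (𝓝 1) := by
  rw [← integral_of_mem_densities hp]
  refine tendsto_integral_of_dominated_convergence p
    (fun k => (measurable_min_mul hp hr k).aestronglyMeasurable) (integrable_of_mem_densities hp)
    (fun k => ae_of_all _ fun x => ?_) (tendsto_min_mul hp hr h)
  rw [Real.norm_of_nonneg (min_mul_nonneg hp hr k x)]
  exact min_le_left _ _

lemma trunc_mem_densities (hp : p ∈ densities X) (hr : r ∈ densities X) {k : ℕ}
    (hk : 0 < truncMass p r k) : trunc p r k ∈ densities X := by
  have hI : Integrable fun x => min (p x) (k * r x) := by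
    -- A nonintegrable function has integral `0` by convention, contradicting the positive mass.
    by_contra hI
    exact hk.ne' (integral_undef hI)
  refine mem_densities_of_integral ((measurable_min_mul hp hr k).const_mul _)
    (fun x => mul_nonneg (inv_nonneg.2 hk.le) (min_mul_nonneg hp hr k x)) (hI.const_mul _) ?_
  simp only [trunc]
  rw [integral_const_mul]
  exact inv_mul_cancel₀ hk.ne'

lemma tendsto_tvDist_trunc (hp : p ∈ densities X) (hr : r ∈ densities X) (h : law p ≪ law r) :
    Tendsto (fun k => tvDist (trunc p r k) p) atTop (𝓝 0) := by
  have hZ := tendsto_truncMass hp hr h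
  have hpi := integrable_of_mem_densities hp
  have h1 : Tendsto (fun k => ∫ x, |trunc p r k x - p x|) atTop (𝓝 (∫ _ : X, (0 : ℝ))) := by
    refine tendsto_integral_filter_of_dominated_convergence (fun x => 2 * p x + p x) ?_ ?_
      ((hpi.const_mul 2).add hpi) ?_
    · exact Eventually.of_forall fun k =>
        ((((measurable_min_mul hp hr k).const_mul _).sub hp.1).norm).aestronglyMeasurable
    · filter_upwards [hZ.eventually_const_lt (show (1 / 2 : ℝ) < 1 by norm_num)] with k hk
      refine ae_of_all _ fun x => ?_
      have h2 : (truncMass p r k)⁻¹ ≤ 2 := by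
        rw [inv_le_comm₀ (by linarith) two_pos]; linarith
      have h3 : 0 ≤ trunc p r k x :=
        mul_nonneg (inv_nonneg.2 (by linarith)) (min_mul_nonneg hp hr k x)
      have h4 : trunc p r k x ≤ 2 * p x :=
        mul_le_mul h2 (min_le_left _ _) (min_mul_nonneg hp hr k x) zero_le_two
      have h5 := hp.2.1 x
      rw [Real.norm_eq_abs, abs_abs, abs_le]
      constructor <;> linarith
    · filter_upwards [tendsto_min_mul hp hr h] with x hx
      have := ((hZ.inv₀ one_ne_zero).mul hx).sub_const (p x)
      simpa [trunc] using this.abs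
  rw [integral_zero] at h1
  have h2 := h1.const_mul (1 / 2)
  rwa [mul_zero] at h2

end Truncation

/-! ### Passage to the limit in the truncation, and the two claims for kernels -/

section KernelEP

variable {X Ω : Type*} [MeasureSpace X] [MeasurableSpace Ω]
  {A B : Kernel X Ω} {i j : Ω → X} {G : (X → ℝ) → EReal} {p r : X → ℝ}

lemma IsProtocol.integral_fwd (hW : IsProtocol A B i j) (hp : p ∈ densities X)
    (hr : r ∈ densities X) (h : law p ≪ law r) (c : Ω → ℝ) :
    (Integrable c (A ∘ₘ law p) ↔ Integrable (fun ω => p (i ω) / r (i ω) * c ω) (A ∘ₘ law r)) ∧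
      ∫ ω, c ω ∂(A ∘ₘ law p) = ∫ ω, p (i ω) / r (i ω) * c ω ∂(A ∘ₘ law r) := by
  have hd : Measurable fun x => p x / r x := hp.1.div hr.1
  have hm := hd.ennreal_ofReal.comp hW.measurable_init
  have hlt : ∀ᵐ ω ∂(A ∘ₘ law r), ((fun x => ENNReal.ofReal (p x / r x)) ∘ i) ω < ∞ :=
    ae_of_all _ fun _ => ENNReal.ofReal_lt_top
  have h0 : ∀ ω, (((fun x => ENNReal.ofReal (p x / r x)) ∘ i) ω).toReal
      = p (i ω) / r (i ω) := fun ω => ENNReal.toReal_ofReal (div_nonneg (hp.2.1 _) (hr.2.1 _))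
  rw [law_eq_withDensity_div hp hr h,
    comp_withDensity_of_retract hW.measurable_init hW.map_init _ hd.ennreal_ofReal,
    integrable_withDensity_iff_integrable_smul' hm hlt,
    integral_withDensity_eq_integral_toReal_smul hm hlt]
  simp only [h0, smul_eq_mul, and_self]

/-- Young's inequality bounds the integrand by `klFun` of the density ratio, integrable as `D(p ‖ r)
< ∞`, plus the exponential of the negative part. The latter is integrable because `exp (-pathEP)` is
the density of the backward law of `r` relative to its forward law. -/
lemma IsProtocol.integrable_neg_pathEP (hW : IsProtocol A B i j) (hG : IsLSCLinear G)
    (hr : r ∈ densities X) (hrfin : kernelEP A B j G r < ⊤) (hp : p ∈ densities X)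
    (hpr : D p r ≠ ∞) :
    Integrable (fun ω => p (i ω) / r (i ω) * max (-pathEP A B j r ω) 0) (A ∘ₘ law r) := by
  have := hW.markov_bwd
  have := hW.isProbabilityMeasure hr
  have := isProbabilityMeasure_law hp
  have := isProbabilityMeasure_law hr
  have : IsProbabilityMeasure (kernelFinalLaw A j r) :=
    Measure.isProbabilityMeasure_map hW.measurable_final.aemeasurable
  have hac := (klDiv_ne_top_iff.1 hpr).1
  have hd : Measurable fun x => p x / r x := hp.1.div hr.1
  have h1 : Integrable (fun ω => Real.exp (-pathEP A B j r ω)) (A ∘ₘ law r) :=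
    (integrable_congr (exp_neg_llr (hW.ac_of_lt_top hG hr hrfin))).2
      Measure.integrable_toReal_rnDeriv
  have h2 : Integrable (fun ω => klFun (p (i ω) / r (i ω))) (A ∘ₘ law r) := by
    have := (D_ne_top_iff hp hr hac).1 hpr
    rw [← map_comp_of_retract (κ := A) hW.measurable_init hW.map_init (law r)] at this
    exact this.comp_measurable hW.measurable_init
  refine (h2.add (h1.add (integrable_const 1))).mono'
    ((hd.comp hW.measurable_init).mul
      ((measurable_llr _ _).neg.max measurable_const)).aestronglyMeasurable
    (ae_of_all _ fun ω => ?_)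
  have h0 : 0 ≤ p (i ω) / r (i ω) := div_nonneg (hp.2.1 _) (hr.2.1 _)
  rw [Real.norm_of_nonneg (mul_nonneg h0 (le_max_right _ _))]
  refine (mul_le_klFun_add_exp h0 _).trans ?_
  simp only [Pi.add_apply]
  gcongr
  rcases le_total (-pathEP A B j r ω) 0 with h | h
  · rw [max_eq_right h, Real.exp_zero]
    linarith [Real.exp_pos (-pathEP A B j r ω)]
  · rw [max_eq_left h]
    linarith

/-- If all truncations of `p` have the same linear part as `r`, then, by lower semicontinuity of
`G`, the linear part of `p` is finite and at most that of `r`. -/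
lemma IsProtocol.lt_top_and_linearEP_le_of_trunc (hW : IsProtocol A B i j) (hG : IsLSCLinear G)
    (hr : r ∈ densities X) (hrfin : kernelEP A B j G r < ⊤) (hp : p ∈ densities X)
    (hpr : D p r ≠ ∞)
    (hk : ∀ k : ℕ, 0 < truncMass p r k → D (trunc p r k) r ≠ ∞ ∧
      kernelEP A B j G (trunc p r k) < ⊤ ∧
      linearEP A B j G r (trunc p r k) = linearEP A B j G r r) :
    kernelEP A B j G p < ⊤ ∧ linearEP A B j G r p ≤ linearEP A B j G r r := by
  have := isProbabilityMeasure_law hp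
  have := isProbabilityMeasure_law hr
  have hac := (klDiv_ne_top_iff.1 hpr).1
  set c := pathEP A B j r
  set Q := A ∘ₘ law r
  set L := linearEP A B j G r r
  set Z := truncMass p r
  have hZ : Tendsto Z atTop (𝓝 1) := tendsto_truncMass hp hr hac
  have hZhalf : ∀ᶠ k in atTop, 1 / 2 < Z k := hZ.eventually_const_lt (by norm_num)
  have hZone : ∀ᶠ k in atTop, Z k < 2 := hZ.eventually_lt_const (by norm_num)
  have hd : Measurable fun x => p x / r x := hp.1.div hr.1
  have hpos : ∀ᵐ ω ∂Q, 0 < r (i ω) := by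
    have := ae_law_pos hr
    rw [← map_comp_of_retract (κ := A) hW.measurable_init hW.map_init (law r)] at this
    exact ae_of_ae_map hW.measurable_init.aemeasurable this
  have hlsc : ∀ a : EReal, a < G p → ∀ᶠ k in atTop, a < G (trunc p r k) := fun a ha => by
    obtain ⟨δ, hδ, h⟩ := hG.lsc p hp a ha
    filter_upwards [(tendsto_tvDist_trunc hp hr hac).eventually_lt_const hδ, hZhalf] with k h1 h2
    exact h _ (trunc_mem_densities hp hr (by linarith)) h1
  have hint : ∀ k, 0 < Z k → Integrable (fun ω => min (p (i ω) / r (i ω)) k * c ω) Q ∧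
      G (trunc p r k) < ⊤ ∧
      ∫ ω, min (p (i ω) / r (i ω)) k * c ω ∂Q = Z k * (L - (G (trunc p r k)).toReal) := by
    intro k hkZ
    obtain ⟨hD, hfin, hlin⟩ := hk k hkZ
    have hm := trunc_mem_densities hp hr hkZ
    have := isProbabilityMeasure_law hm
    obtain ⟨hi, hGk⟩ := (hW.kernelEP_lt_top_iff_integrable hG hr hrfin hm hD).1 hfin
    obtain ⟨h1, h2⟩ := hW.integral_fwd hm hr (klDiv_ne_top_iff.1 hD).1 c
    have heq : (fun ω => trunc p r k (i ω) / r (i ω) * c ω) =ᵐ[Q]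
        fun ω => (Z k)⁻¹ * (min (p (i ω) / r (i ω)) k * c ω) := by
      filter_upwards [hpos] with ω hω
      have : min (p (i ω)) (k * r (i ω)) / r (i ω) = min (p (i ω) / r (i ω)) k := by
        rw [← min_div_div_right hω.le, mul_div_cancel_right₀ _ hω.ne']
      rw [trunc, mul_div_assoc, this, mul_assoc]
    have h3 := (integrable_congr heq).1 (h1.1 hi)
    rw [integrable_const_mul_iff (isUnit_iff_ne_zero.2 (inv_ne_zero hkZ.ne'))] at h3
    refine ⟨h3, hGk, ?_⟩
    rw [integral_congr_ae heq, integral_const_mul] at h2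
    rw [linearEP, h2] at hlin
    rw [← hlin]
    field_simp
    ring
  -- By lower semicontinuity `m` eventually bounds `G` on the truncations from below, hence their
  -- path terms from above.
  obtain ⟨m, hm⟩ : ∃ m : ℝ, (m : EReal) < G p := by
    by_contra! h
    exact hG.ne_bot p hp ((EReal.eq_bot_iff_forall_lt _).2 fun y =>
      (h (y - 1)).trans_lt (EReal.coe_lt_coe_iff.2 (by linarith)))
  have hbound : ∀ᶠ k : ℕ in atTop,
      Integrable (fun ω => min (p (i ω) / r (i ω)) k * c ω) Q ∧
      ∫ ω, min (p (i ω) / r (i ω)) k * c ω ∂Q ≤ 2 * |L - m| := by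
    filter_upwards [hlsc m hm, hZhalf, hZone] with k h1 h2 h3
    obtain ⟨h4, h5, h6⟩ := hint k (by linarith)
    refine ⟨h4, h6.trans_le ?_⟩
    have h7 : m ≤ (G (trunc p r k)).toReal := by
      rw [← EReal.coe_le_coe_iff]
      exact h1.le.trans (EReal.le_coe_toReal h5.ne)
    exact (mul_le_mul_of_nonneg_left
      ((sub_le_sub_left h7 L).trans (le_abs_self _)) (by linarith)).trans
      (mul_le_mul_of_nonneg_right h3.le (abs_nonneg _))
  obtain ⟨hI, hlim⟩ := integrable_and_tendsto_of_truncation (Q := Q)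
    (H := fun ω => p (i ω) / r (i ω)) (c := c) (hd.comp hW.measurable_init)
    (fun ω => div_nonneg (hp.2.1 _) (hr.2.1 _)) (measurable_llr _ _)
    (hW.integrable_neg_pathEP hG hr hrfin hp hpr) hbound
  obtain ⟨hiff, hval⟩ := hW.integral_fwd hp hr hac c
  -- On truncations `L` is constant, so convergence of the path terms forces convergence of `G`.
  have hGlim : Tendsto (fun k => (G (trunc p r k)).toReal) atTop
      (𝓝 (L - ∫ ω, c ω ∂(A ∘ₘ law p))) := by
    have h1 := (hlim.mul (hZ.inv₀ one_ne_zero)).const_sub L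
    rw [inv_one, mul_one] at h1
    rw [hval]
    refine h1.congr' ?_
    filter_upwards [hZhalf] with k hkZ
    have hkZ' : 0 < Z k := by linarith
    rw [(hint k hkZ').2.2]
    field_simp
    ring
  have hGp : G p ≤ ((L - ∫ ω, c ω ∂(A ∘ₘ law p) : ℝ) : EReal) := by
    refine le_of_forall_lt fun a ha => ?_
    obtain ⟨b, hab, hb⟩ := EReal.lt_iff_exists_real_btwn.1 ha
    refine hab.trans_le (EReal.coe_le_coe_iff.2 (ge_of_tendsto hGlim ?_))
    filter_upwards [hlsc b hb, hZhalf] with k h1 h2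
    rw [← EReal.coe_le_coe_iff]
    exact h1.le.trans (EReal.le_coe_toReal (hint k (by linarith)).2.1.ne)
  have hGfin : G p < ⊤ := hGp.trans_lt (EReal.coe_lt_top _)
  refine ⟨(hW.kernelEP_lt_top_iff_integrable hG hr hrfin hp hpr).2 ⟨hiff.2 hI, hGfin⟩, ?_⟩
  have : (G p).toReal ≤ L - ∫ ω, c ω ∂(A ∘ₘ law p) := by
    rw [← EReal.coe_le_coe_iff, EReal.coe_toReal hGfin.ne (hG.ne_bot p hp)]
    exact hGp
  rw [linearEP]
  linarith

lemma convex_densitiesOn (P : Set X) : Convex ℝ (densitiesOn P) := by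
  intro r hr p hp a b ha hb hab
  obtain rfl : a = 1 - b := by linarith
  refine ⟨mix_mem_densities hr.1 hp.1 hb (by linarith), fun x hx => ?_⟩
  by_contra hxP
  have h1 : r x = 0 := le_antisymm (not_lt.1 fun h => hxP (hr.2 x h)) (hr.1.2.1 x)
  have h2 : p x = 0 := le_antisymm (not_lt.1 fun h => hxP (hp.2 x h)) (hp.1.2.1 x)
  simp [h1, h2] at hx

lemma segment_mem {X : Type*} {p r : X → ℝ} {S : Set (X → ℝ)} (hS : Convex ℝ S) (hr : r ∈ S) (hp : p ∈ S) {l : ℝ}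
    (hl0 : 0 < l) (hl1 : l < 1) : (1 - l) • r + l • p ∈ S :=
  hS hr hp (by linarith) hl0.le (by ring)

theorem IsProtocol.densitiesOn_minimizer (hW : IsProtocol A B i j) (hG : IsLSCLinear G)
    (P : Set X) (hr : IsMinimizer (kernelEP A B j G) (densitiesOn P) r) (hp : p ∈ densitiesOn P)
    (hpr : D p r < ∞) :
    klDiv (kernelFinalLaw A j p) (kernelFinalLaw A j r) < ∞ ∧ kernelEP A B j G p < ⊤ ∧
      kernelEP A B j G p - kernelEP A B j G r = (D p r : EReal)
        - (klDiv (kernelFinalLaw A j p) (kernelFinalLaw A j r) : EReal) := by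
  have hrd := hr.mem.1
  have hconv := convex_densitiesOn P
  have hmin : ∀ q ∈ densitiesOn P, ∀ l : ℝ, 0 < l → l < 1 →
      kernelEP A B j G r ≤ kernelEP A B j G ((1 - l) • r + l • q) := fun q hq l h0 h1 =>
    hr.min _ (segment_mem hconv hr.mem hq h0 h1)
  obtain ⟨hfin, hle⟩ := hW.lt_top_and_linearEP_le_of_trunc hG hrd hr.lt_top hp.1 hpr.ne
    fun k hkZ => by
      have hq := trunc_mem_densities hp.1 hrd hkZ
      have hq0 : ∀ x, r x = 0 → trunc p r k x = 0 := fun x hx => by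
        rw [trunc, hx, mul_zero, min_eq_right (hp.1.2.1 x), mul_zero]
      have hqP : trunc p r k ∈ densitiesOn P := ⟨hq, fun x hx =>
        hr.mem.2 x (lt_of_le_of_ne (hrd.2.1 x) fun h => hx.ne' (hq0 x h.symm))⟩
      -- The truncation is at most `C r`; the `+ 1` makes `C` positive without a case distinction on
      -- `k`.
      have hC : 0 < (truncMass p r k)⁻¹ * k + 1 :=
        add_pos_of_nonneg_of_pos (mul_nonneg (inv_nonneg.2 hkZ.le) k.cast_nonneg) one_pos
      set C := (truncMass p r k)⁻¹ * k + 1 with hC_def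
      have hqle : ∀ x, trunc p r k x ≤ C * r x := fun x => by
        have h1 : trunc p r k x ≤ (truncMass p r k)⁻¹ * (k * r x) :=
          mul_le_mul_of_nonneg_left (min_le_right _ _) (inv_nonneg.2 hkZ.le)
        rw [hC_def, add_mul, mul_assoc]
        linarith [hrd.2.1 x]
      have hsx : ∀ x, ((1 - -C⁻¹) • r + (-C⁻¹) • trunc p r k) x
          = r x + C⁻¹ * (r x - trunc p r k x) := fun x => by
        simp only [Pi.add_apply, Pi.smul_apply, smul_eq_mul]; ring
      -- Prolonging by `l = -C⁻¹` keeps the function nonnegative, as it subtracts at most `r` from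
      -- `(1 + C⁻¹) r`.
      have hs : (1 - -C⁻¹) • r + (-C⁻¹) • trunc p r k ∈ densities X :=
        affine_mem_densities hrd hq _ fun x => by
          have h1 := mul_le_mul_of_nonneg_left (hqle x) (inv_nonneg.2 hC.le)
          rw [inv_mul_cancel_left₀ hC.ne'] at h1
          have h2 := mul_nonneg (inv_nonneg.2 hC.le) (hrd.2.1 x)
          rw [hsx, mul_sub]
          linarith
      have hsP : (1 - -C⁻¹) • r + (-C⁻¹) • trunc p r k ∈ densitiesOn P := ⟨hs, fun x hx =>
        hr.mem.2 x (lt_of_le_of_ne (hrd.2.1 x) fun h => by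
          rw [hsx, hq0 x h.symm, ← h] at hx
          simp at hx)⟩
      refine hW.linearEP_eq_of_prolong hG hrd hr.lt_top hq (neg_lt_zero.2 (inv_pos.2 hC)) hs ?_
      rintro q (rfl | rfl)
      exacts [hmin _ hqP, hmin _ hsP]
  have hge := hW.linearEP_le hG hrd hr.lt_top hp.1 hpr.ne hfin (hmin p hp)
  refine ⟨(hW.klDiv_final_le hp.1 hrd).trans_lt hpr, hfin, ?_⟩
  rw [hW.kernelEP_sub_eq hG hrd hr.lt_top hp.1 hpr.ne hfin, le_antisymm hle hge]
  simp

theorem IsProtocol.convex_minimizer (hW : IsProtocol A B i j) (hG : IsLSCLinear G)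
    {S : Set (X → ℝ)} (hS : S ⊆ densities X) (hconv : Convex ℝ S)
    (hr : IsMinimizer (kernelEP A B j G) S r) (hp : p ∈ S) (hpr : D p r < ∞) :
    klDiv (kernelFinalLaw A j p) (kernelFinalLaw A j r) < ∞ ∧
      kernelEP A B j G p - kernelEP A B j G r ≥ (D p r : EReal)
        - (klDiv (kernelFinalLaw A j p) (kernelFinalLaw A j r) : EReal) ∧
      ((∃ l : ℝ, l < 0 ∧ (1 - l) • r + l • p ∈ S) → kernelEP A B j G p < ⊤ ∧
        kernelEP A B j G p - kernelEP A B j G r = (D p r : EReal)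
          - (klDiv (kernelFinalLaw A j p) (kernelFinalLaw A j r) : EReal)) := by
  have hrd := hS hr.mem
  have hpd := hS hp
  have hmin : ∀ q ∈ S, ∀ l : ℝ, 0 < l → l < 1 →
      kernelEP A B j G r ≤ kernelEP A B j G ((1 - l) • r + l • q) := fun q hq l h0 h1 =>
    hr.min _ (segment_mem hconv hr.mem hq h0 h1)
  refine ⟨(hW.klDiv_final_le hpd hrd).trans_lt hpr, ?_, ?_⟩
  · by_cases hfin : kernelEP A B j G p < ⊤
    · have hge := hW.linearEP_le hG hrd hr.lt_top hpd hpr.ne hfin (hmin p hp)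
      rw [hW.kernelEP_sub_eq hG hrd hr.lt_top hpd hpr.ne hfin]
      exact le_add_of_nonneg_right (EReal.coe_nonneg.2 (sub_nonneg.2 hge))
    -- When `Σ(p) = ⊤` the left side is `⊤`, because `Σ(r)` is real.
    · rw [not_lt_top_iff.1 hfin, hW.kernelEP_self hG hrd hr.lt_top, EReal.top_sub_coe]
      exact le_top
  · rintro ⟨l, hl, hs⟩
    obtain ⟨-, hfin, heq⟩ := hW.linearEP_eq_of_prolong hG hrd hr.lt_top hpd hl (hS hs) (by
      rintro q (rfl | rfl)
      exacts [hmin _ hp, hmin _ hs])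
    refine ⟨hfin, ?_⟩
    rw [hW.kernelEP_sub_eq hG hrd hr.lt_top hpd hpr.ne hfin, heq]
    simp

end KernelEP

/-! ### Trajectory and system–bath forms as pairs of kernels -/

section Forms

variable {X : Type*} [MeasureSpace X]

lemma DrivenProcess.measurable_reverse (W : DrivenProcess X) : Measurable W.reverse :=
  measurable_pi_lambda _ fun _ => W.measurable_conj.comp (measurable_pi_apply _)

/-- The backward trajectory distribution as a kernel from the final state. -/
noncomputable def DrivenProcess.bwdKernel (W : DrivenProcess X) :
    Kernel X (Trajectory X W.τ) :=
  (W.bwd.comap W.conj W.measurable_conj).map W.reverse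

/-- The final point of a reversed trajectory is the conjugate of the starting point of the backward
one, itself a conjugate; the involution cancels. -/
lemma DrivenProcess.isProtocol (W : DrivenProcess X) :
    IsProtocol W.fwd W.bwdKernel (fun x => x ⟨0, le_rfl, W.τ_nonneg⟩)
      (fun x => x ⟨W.τ, W.τ_nonneg, le_rfl⟩) where
  markov_fwd := W.fwd_markov
  markov_bwd := by
    have := W.bwd_markov
    exact Kernel.IsMarkovKernel.map _ W.measurable_reverse
  measurable_init := measurable_pi_apply _
  measurable_final := measurable_pi_apply _
  map_init := W.fwd_start
  map_final x := by
    rw [bwdKernel, Kernel.map_apply _ W.measurable_reverse, Kernel.comap_apply,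
      Measure.map_map (measurable_pi_apply _) W.measurable_reverse]
    have h : (fun x : Trajectory X W.τ => x ⟨W.τ, W.τ_nonneg, le_rfl⟩) ∘ W.reverse
        = W.conj ∘ fun x => x ⟨0, le_rfl, W.τ_nonneg⟩ := by
      ext x
      simp [reverse]
    rw [h, ← Measure.map_map W.measurable_conj (measurable_pi_apply _), W.bwd_start,
      Measure.map_dirac' W.measurable_conj, W.conj_conj]

lemma DrivenProcess.ep_eq_kernelEP (W : DrivenProcess X) (G : (X → ℝ) → EReal) :
    W.ep G = kernelEP W.fwd W.bwdKernel (fun x => x ⟨W.τ, W.τ_nonneg, le_rfl⟩) G := by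
  ext p
  have h : W.backwardLaw p = W.bwdKernel ∘ₘ W.finalLaw p := by
    rw [backwardLaw, bwdKernel, ← Measure.map_comp _ _ W.measurable_reverse,
      ← Kernel.comp_deterministic_eq_comap, ← Measure.comp_assoc,
      Measure.deterministic_comp_eq_map]
  rw [ep, h]
  rfl

variable {Y : Type*} [MeasureSpace Y]

/-- The joint evolution of system and bath, as a kernel from the initial state of the system. -/
noncomputable def SystemBath.fwdKernel (W : SystemBath X Y) : Kernel X (X × Y) :=
  (Kernel.id ×ₖ W.q).map W.flow

lemma map_fst_id_prod (q : Kernel X Y) [IsMarkovKernel q] (x : X) :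
    ((Kernel.id ×ₖ q) x).map Prod.fst = Measure.dirac x := by
  rw [← Kernel.map_apply _ measurable_fst, ← Kernel.fst_eq, Kernel.fst_prod, Kernel.id_apply]

/-- The role of a path is played by the final joint state: inverting the flow recovers the initial
system state. -/
lemma SystemBath.isProtocol (W : SystemBath X Y) :
    IsProtocol W.fwdKernel (Kernel.id ×ₖ W.q) (Prod.fst ∘ W.flow.symm) Prod.fst := by
  have := W.q_markov
  refine ⟨Kernel.IsMarkovKernel.map _ W.flow.measurable, inferInstance,
    measurable_fst.comp W.flow.symm.measurable, measurable_fst, fun x => ?_, map_fst_id_prod W.q⟩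
  rw [fwdKernel, Kernel.map_apply _ W.flow.measurable,
    Measure.map_map (measurable_fst.comp W.flow.symm.measurable) W.flow.measurable,
    ← map_fst_id_prod W.q x]
  congr 1
  ext z
  simp

/-- Restricting to densities makes `law p` finite, so `compProd` does not take its default value. -/
lemma SystemBath.finalJointLaw_eq (W : SystemBath X Y) {p : X → ℝ} (hp : p ∈ densities X) :
    W.finalJointLaw p = W.fwdKernel ∘ₘ law p := by
  have := W.q_markov
  have := isProbabilityMeasure_law hp
  rw [finalJointLaw, fwdKernel, ← Measure.map_comp _ _ W.flow.measurable,
    Measure.compProd_eq_comp_prod]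

lemma SystemBath.finalLaw_eq (W : SystemBath X Y) {p : X → ℝ} (hp : p ∈ densities X) :
    W.finalLaw p = kernelFinalLaw W.fwdKernel Prod.fst p := by
  rw [finalLaw, W.finalJointLaw_eq hp, kernelFinalLaw]

lemma SystemBath.ep_eq_kernelEP (W : SystemBath X Y) (G : (X → ℝ) → EReal) {p : X → ℝ}
    (hp : p ∈ densities X) :
    W.ep G p = kernelEP W.fwdKernel (Kernel.id ×ₖ W.q) Prod.fst G p := by
  have := W.q_markov
  have := W.isProtocol.isProbabilityMeasure hp
  have : IsProbabilityMeasure (kernelFinalLaw W.fwdKernel Prod.fst p) :=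
    Measure.isProbabilityMeasure_map measurable_fst.aemeasurable
  rw [ep, kernelEP, W.finalJointLaw_eq hp, W.finalLaw_eq hp, Measure.compProd_eq_comp_prod]

/-- Both forms of entropy production are instances of the form given by a pair of kernels. -/
lemma IsEPType.exists_isProtocol.{u} {X : Type u} [MeasureSpace X] {Sig : (X → ℝ) → EReal}
    {T : (X → ℝ) → Measure X} (h : IsEPType Sig T) :
    ∃ (Ω : Type u) (_ : MeasurableSpace Ω) (A B : Kernel X Ω) (i j : Ω → X)
      (G : (X → ℝ) → EReal), IsProtocol A B i j ∧ IsLSCLinear G ∧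
      (∀ p ∈ densities X, Sig p = kernelEP A B j G p) ∧
      ∀ p ∈ densities X, T p = kernelFinalLaw A j p := by
  cases h with
  | trajectory W G hG =>
    exact ⟨Trajectory X W.τ, inferInstance, W.fwd, W.bwdKernel, _, _, G, W.isProtocol, hG,
      fun p _ => congrFun (W.ep_eq_kernelEP G) p, fun p _ => rfl⟩
  | systemBath m Y hY W G hG =>
    exact ⟨X × Y, inferInstance, W.fwdKernel, Kernel.id ×ₖ W.q, _, _, G, W.isProtocol, hG,
      fun p hp => W.ep_eq_kernelEP G hp, fun p hp => W.finalLaw_eq hp⟩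

lemma IsMinimizer.congr {X : Type*} {Sig Sig' : (X → ℝ) → EReal} {S : Set (X → ℝ)} {r : X → ℝ}
    (h : ∀ w ∈ S, Sig w = Sig' w) (hr : IsMinimizer Sig S r) : IsMinimizer Sig' S r :=
  ⟨hr.mem, fun w hw => h r hr.mem ▸ h w hw ▸ hr.min w hw, h r hr.mem ▸ hr.lt_top⟩

end Forms

end ClassicalEP

theorem mainTheorem11 {n : ℕ} (X : Set (EuclideanSpace ℝ (Fin n))) (hX : MeasurableSet X)
    (Sig : (X → ℝ) → EReal) (T : (X → ℝ) → Measure X) (hSig : IsEPType Sig T) :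
    -- equality for a minimizer over the densities supported in `P`
    (∀ P : Set X, MeasurableSet P → ∀ r, IsMinimizer Sig (densitiesOn P) r →
      ∀ p ∈ densitiesOn P, D p r < ∞ →
        klDiv (T p) (T r) < ∞ ∧ Sig p < ⊤ ∧
        Sig p - Sig r = (D p r : EReal) - (klDiv (T p) (T r) : EReal)) ∧
    -- inequality for a minimizer over an arbitrary convex set of densities
    (∀ S : Set (X → ℝ), S ⊆ densities X → Convex ℝ S → ∀ r, IsMinimizer Sig S r →
      ∀ p ∈ S, D p r < ∞ →
        klDiv (T p) (T r) < ∞ ∧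
        Sig p - Sig r ≥ (D p r : EReal) - (klDiv (T p) (T r) : EReal) ∧
        -- with equality if the segment from `p` to `r` can be prolonged beyond `r` within `S`
        ((∃ l : ℝ, l < 0 ∧ (1 - l) • r + l • p ∈ S) →
          Sig p < ⊤ ∧
          Sig p - Sig r = (D p r : EReal) - (klDiv (T p) (T r) : EReal))) := by
  obtain ⟨Ω, _, A, B, i, j, G, hW, hG, hEP, hT⟩ := hSig.exists_isProtocol
  constructor
  · intro P _ r hr p hp hpr
    rw [hEP p hp.1, hEP r hr.mem.1, hT p hp.1, hT r hr.mem.1]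
    exact hW.densitiesOn_minimizer hG P (hr.congr fun w hw => hEP w hw.1) hp hpr
  · intro S hS hconv r hr p hp hpr
    rw [hEP p (hS hp), hEP r (hS hr.mem), hT p (hS hp), hT r (hS hr.mem)]
    exact hW.convex_minimizer hG hS hconv (hr.congr fun w hw => hEP w (hS hw)) hp hpr
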